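/- Let $G$ be a finite simple unicyclic graph (that is, $G$ is connected and has as many edges as vertices) with $n$ vertices. Let $C_l = v_1v_2\cdots v_lv_1$ ($l\ge 3$) be its unique cycle, and for $1\le i\le l$ let $T_i$ be the component containing $v_i$ of the graph obtained from $G$ by deleting the edges of $C_l$; each $T_i$ is a tree. Let $x$ be a vertex of $T_k$. Notation. $d(x,y)$ is the distance in $G$, and $D_{T_i}(v_i)=\sum_{y\in V(T_i)} d_{T_i}(v_i,y)$ is the sum of the distances in $T_i$ from $v_i$. For the simple random walk on $G$, which jumps from its current vertex to each of that vertex's neighbours with equal probability, $H_{xy}$ is the expected value of $\inf\{j\ge 0 : X_j=y\}$ when $X_0=x$; the cover cost and the reverse cover cost of $x$ are $CC(x)=\sum_{y\in V(G)}H_{xy}$ and $RC(x)=\sum_{y\in V(G)}H_{yx}$. Further, $r(x,y)$ is the effective resistance between $x$ and $y$ when every edge of $G$ is a unit resistor, $R(x)=\sum_{y\in V(G)} r(x,y)$ and $K\!f(G)=\sum_{\{x,y\}\subseteq V(G)}r(x,y)$ is the Kirchhoff index. Then $CC(x)$ and $RC(x)$ are finite, and \begin{itemize} \item[(i)] $CC(x)=2K\!f(G)+\sum_{i=1}^{l}D_{T_i}(v_i)-n\,d(x,v_k)$;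 \item[(ii)] $RC(x)=2nR(x)-2K\!f(G)-\sum_{i=1}^{l}D_{T_i}(v_i)+n\,d(x,v_k)$. \end{itemize} -/

import Mathlib

open MeasureTheory ProbabilityTheory
open scoped ENNReal

namespace UnicyclicWalk

variable {V : Type*} [Fintype V] [DecidableEq V]

/-! ### Simple random walk, hitting times and cover costs -/

/-- One step of the simple random walk: from `x` jump to a uniformly chosen neighbour of `x`, so to
each neighbour with probability `1 / d(x)` (by convention, stay put at an isolated vertex). -/
noncomputable def stepLaw (G : SimpleGraph V) [DecidableRel G.Adj] (x : V) : PMF V :=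
  if h : (G.neighborFinset x).Nonempty then PMF.uniformOfFinset (G.neighborFinset x) h
  else PMF.pure x

/-- The transition kernel of the simple random walk. -/
noncomputable def stepKernel [MeasurableSpace V] [DiscreteMeasurableSpace V]
    (G : SimpleGraph V) [DecidableRel G.Adj] : Kernel V V where
  toFun x := (stepLaw G x).toMeasure
  measurable' := Measurable.of_discrete

instance [MeasurableSpace V] [DiscreteMeasurableSpace V]
    (G : SimpleGraph V) [DecidableRel G.Adj] : IsMarkovKernel (stepKernel G) :=
  ⟨fun x => PMF.toMeasure.isProbabilityMeasure (stepLaw G x)⟩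

/-- The law, on the space `ℕ → V` of trajectories, of the simple random walk
`X₀, X₁, X₂, …` on `G` started at `x`: the Markov chain with `X₀ = x` in which, given
`X₀, …, X_n`, the next position is drawn from the one-step law at `X_n`. -/
noncomputable def walkLaw [MeasurableSpace V] [DiscreteMeasurableSpace V]
    (G : SimpleGraph V) [DecidableRel G.Adj] (x : V) : Measure (ℕ → V) :=
  Kernel.trajMeasure (X := fun _ : ℕ => V) (Measure.dirac x) fun n =>
    (stepKernel G).comap (fun p : (i : Finset.Iic n) → V => p ⟨n, Finset.mem_Iic.2 le_rfl⟩)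
      (measurable_pi_apply _)

/-- The hitting time `T_y = inf {k ≥ 0 : X_k = y}` of a trajectory; it is `∞` if `y` is never
reached. -/
noncomputable def hittingTime (y : V) (ω : ℕ → V) : ℝ≥0∞ :=
  ⨅ (k : ℕ) (_ : ω k = y), (k : ℝ≥0∞)

/-- The expected hitting time `H_{xy}` of `y` for the walk started at `x`. -/
noncomputable def expectedHittingTime [MeasurableSpace V] [DiscreteMeasurableSpace V]
    (G : SimpleGraph V) [DecidableRel G.Adj] (x y : V) : ℝ≥0∞ :=
  ∫⁻ ω, hittingTime y ω ∂(walkLaw G x)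

/-- The cover cost `CC(x) = ∑_y H_{xy}`. -/
noncomputable def coverCost [MeasurableSpace V] [DiscreteMeasurableSpace V]
    (G : SimpleGraph V) [DecidableRel G.Adj] (x : V) : ℝ≥0∞ :=
  ∑ y, expectedHittingTime G x y

/-- The reverse cover cost `RC(x) = ∑_y H_{yx}`. -/
noncomputable def reverseCoverCost [MeasurableSpace V] [DiscreteMeasurableSpace V]
    (G : SimpleGraph V) [DecidableRel G.Adj] (x : V) : ℝ≥0∞ :=
  ∑ y, expectedHittingTime G y x

/-! ### Resistance distance, resistance-centrality and the Kirchhoff index -/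

/-- `f` is the electrical potential of a unit current that enters at `x` and leaves at `y`, when
every edge of `G` is a unit resistor. By Ohm's law the current along an edge from `v` to `w` is
`f v - f w`; by Kirchhoff's law the net current out of `v` is the external current at `v`. -/
def IsUnitCurrentPotential (G : SimpleGraph V) [DecidableRel G.Adj] (x y : V) (f : V → ℝ) : Prop :=
  ∀ v, ∑ w ∈ G.neighborFinset v, (f v - f w) =
    (if v = x then 1 else 0) - (if v = y then 1 else 0)

/-- The resistance distance `r(x, y)`: the effective resistance between `x` and `y`, that is, the
potential difference that drives a unit current from `x` to `y`. When `G` is connected, the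
potential exists and is unique up to an additive constant, and the set below has exactly one
element. -/
noncomputable def resistanceDist (G : SimpleGraph V) [DecidableRel G.Adj] (x y : V) : ℝ :=
  sInf {t | ∃ f : V → ℝ, IsUnitCurrentPotential G x y f ∧ t = f x - f y}

/-- Resistance distance is symmetric (reverse the current). -/
theorem resistanceDist_comm (G : SimpleGraph V) [DecidableRel G.Adj] (x y : V) :
    resistanceDist G x y = resistanceDist G y x := by
  have key : ∀ a b : V, {t | ∃ f : V → ℝ, IsUnitCurrentPotential G a b f ∧ t = f a - f b} ⊆
      {t | ∃ f : V → ℝ, IsUnitCurrentPotential G b a f ∧ t = f b - f a} := by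
    rintro a b t ⟨f, hf, rfl⟩
    refine ⟨fun v => -f v, fun v => ?_, by ring⟩
    have h := congrArg Neg.neg (hf v)
    rw [← Finset.sum_neg_distrib] at h
    rw [neg_sub] at h
    rw [← h]
    exact Finset.sum_congr rfl fun w _ => by ring
  unfold resistanceDist
  rw [Set.Subset.antisymm (key x y) (key y x)]

/-- The resistance-centrality `R(x) = ∑_y r(x, y)`. -/
noncomputable def resistanceCentrality (G : SimpleGraph V) [DecidableRel G.Adj] (x : V) : ℝ :=
  ∑ y, resistanceDist G x y

/-- The Kirchhoff index `Kf(G)`: the sum of `r(x, y)` over all unordered pairs of distinct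
vertices. -/
noncomputable def kirchhoffIndex (G : SimpleGraph V) [DecidableRel G.Adj] : ℝ :=
  ∑ p : Sym2 V with ¬ p.IsDiag, Sym2.lift ⟨resistanceDist G, resistanceDist_comm G⟩ p

/-! ### Centrality and the trees of a unicyclic graph -/

/-- The centrality (transmission) `D(x) = ∑_y d(x, y)` of a vertex of a finite graph. -/
noncomputable def centrality {W : Type*} [Finite W] (H : SimpleGraph W) (x : W) : ℕ :=
  letI := Fintype.ofFinite W
  ∑ y, H.dist x y

/-- For a cycle `C = v_1 v_2 … v_l v_1` in `G`, the tree `T_i`: the component that contains `v_i` of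
the graph `G - E_C` obtained by deleting the edges of `C`. -/
def cycleTree {V : Type*} (G : SimpleGraph V) {l : ℕ} (v : (SimpleGraph.cycleGraph l).Copy G)
    (i : Fin l) : (G.deleteEdges v.toSubgraph.edgeSet).ConnectedComponent :=
  (G.deleteEdges v.toSubgraph.edgeSet).connectedComponentMk (v i)

/-- The centrality `D_{T_i}(v_i)` of `v_i` in the graph `T_i`. -/
noncomputable def cycleTreeCentrality {V : Type*} [Finite V] (G : SimpleGraph V) {l : ℕ}
    (v : (SimpleGraph.cycleGraph l).Copy G) (i : Fin l) : ℕ :=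
  centrality (cycleTree G v i).toSimpleGraph
    ⟨v i, SimpleGraph.ConnectedComponent.connectedComponentMk_mem⟩

end UnicyclicWalk

/-! Write `L` for the graph Laplacian, `n` and `m` for the numbers of vertices and edges, `δ` for
the distance to the cycle. First-step analysis gives `L H(·,y) = deg` off `y`, and since a Laplacian
sums to zero, its value at `y` is `deg y - 2m`. Summing over `y` gives `L CC = n deg - 2m`, which is
`n (deg - 2)` when `m = n`.

On the other hand `L δ = 2 - deg` (`laplacian_cycleDist`): off the cycle, one neighbour is closer
and all others are farther; on it, two neighbours are at distance 0 and all others at distance 1.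
This rests on `adj_cases`, an edge count. Hence `CC + n δ` is harmonic, so constant on the connected
graph.

The constant is found by averaging. Differences of hitting times are potentials, which gives the
commute time identity; summed over all pairs it yields `∑ CC = 2n Kf`. Thus `CC(x) = 2 Kf + ∑ δ - n
δ(x)`. Inside `T_i`, `δ` is the distance to `v_i`, both in the tree and in `G`, which gives (i);
(ii) follows from `CC + RC = 2n R`. -/

set_option linter.unusedSectionVars false

namespace UnicyclicWalk

/-! ### The law of the walk -/

section Walk

variable {V : Type*} [Fintype V] [DecidableEq V] [MeasurableSpace V] [DiscreteMeasurableSpace V]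
  (G : SimpleGraph V) [DecidableRel G.Adj]

theorem lintegral_stepKernel {x : V} (hx : (G.neighborFinset x).Nonempty) (f : V → ℝ≥0∞) :
    ∫⁻ z, f z ∂(stepKernel G x) = ∑ w ∈ G.neighborFinset x, (G.degree x : ℝ≥0∞)⁻¹ * f w := by
  have h : stepKernel G x = (PMF.uniformOfFinset (G.neighborFinset x) hx).toMeasure := by
    change (stepLaw G x).toMeasure = _
    rw [stepLaw, dif_pos hx]
  rw [h, lintegral_fintype]
  simp_rw [PMF.toMeasure_apply_singleton _ _ (measurableSet_singleton _),
    PMF.uniformOfFinset_apply, SimpleGraph.card_neighborFinset_eq_degree, mul_ite, mul_zero]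
  rw [Finset.sum_ite_mem, Finset.univ_inter]
  exact Finset.sum_congr rfl fun w _ => mul_comm _ _

theorem lintegral_walkLaw_zero (x : V) (f : V → ℝ≥0∞) :
    ∫⁻ ω, f (ω 0) ∂(walkLaw G x) = f x := by
  have hf : Measurable f := Measurable.of_discrete
  have h0 : (fun ω : ℕ → V => f (ω 0)) =
      (fun p : (i : Finset.Iic 0) → V => f (p ⟨0, Finset.mem_Iic.2 le_rfl⟩)) ∘
        Preorder.frestrictLe (π := fun _ => V) 0 := rfl
  have hm : Measurable fun p : (i : Finset.Iic 0) → V => f (p ⟨0, Finset.mem_Iic.2 le_rfl⟩) :=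
    hf.comp (measurable_pi_apply _)
  rw [h0]
  simp only [Function.comp_def]
  rw [← lintegral_map hm (by fun_prop), walkLaw, Kernel.trajMeasure,
    Measure.map_comp _ _ (by fun_prop), Kernel.traj_map_frestrictLe, Kernel.partialTraj_self,
    Measure.id_comp, lintegral_map hm (by fun_prop), lintegral_dirac' _ (by fun_prop)]
  rfl

/-- The Markov property in integrated form: the disintegration of `trajMeasure` at time `k`, tested
against a function of the past times a function of the next position. -/
theorem lintegral_walkLaw_succ (x : V) (k : ℕ) {F : ((i : Finset.Iic k) → V) → ℝ≥0∞}
    (hF : Measurable F) (g : V → ℝ≥0∞) :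
    ∫⁻ ω, F (Preorder.frestrictLe k ω) * g (ω (k + 1)) ∂(walkLaw G x) =
      ∫⁻ ω, F (Preorder.frestrictLe k ω) * ∫⁻ z, g z ∂(stepKernel G (ω k)) ∂(walkLaw G x) := by
  have hg : Measurable g := Measurable.of_discrete
  have key := Kernel.map_frestrictLe_trajMeasure_compProd_eq_map_trajMeasure
    (X := fun _ : ℕ => V) (μ₀ := Measure.dirac x) (a := k)
    (κ := fun n => (stepKernel G).comap
      (fun p : (i : Finset.Iic n) → V => p ⟨n, Finset.mem_Iic.2 le_rfl⟩)
      (measurable_pi_apply _))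
  have hm : Measurable fun q : ((i : Finset.Iic k) → V) × V => F q.1 * g q.2 := by fun_prop
  have hl := congrArg (fun μ => ∫⁻ q, F q.1 * g q.2 ∂μ) key
  beta_reduce at hl
  rw [Measure.lintegral_compProd hm, lintegral_map hm (by fun_prop), lintegral_map _ (by fun_prop)]
    at hl
  · refine Eq.trans hl.symm ?_
    refine lintegral_congr fun ω => ?_
    exact lintegral_const_mul (μ := stepKernel G (ω k)) (F (Preorder.frestrictLe k ω)) hg
  · exact Measurable.lintegral_kernel_prod_right' hm

end Walk

/-! ### Hitting times -/

section Hitting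

variable {V : Type*} [Fintype V] [DecidableEq V]

/-- The trajectories avoiding `y` up to time `k`. -/
def avoid (y : V) (k : ℕ) : Set (ℕ → V) := {ω | ∀ j ≤ k, ω j ≠ y}

/-- The tail-sum formula `T = ∑ 1{T > k}`, valid also for `T = ∞`. -/
theorem hittingTime_eq_tsum (y : V) (ω : ℕ → V) :
    hittingTime y ω = ∑' k, (avoid y k).indicator 1 ω := by
  classical
  by_cases h : ∃ k, ω k = y
  · have hm : hittingTime y ω = (Nat.find h : ℝ≥0∞) := by
      refine le_antisymm (iInf₂_le (f := fun (k : ℕ) (_ : ω k = y) => (k : ℝ≥0∞)) _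
        (Nat.find_spec h)) ?_
      exact le_iInf₂ fun k hk => by exact_mod_cast Nat.find_min' h hk
    rw [hm, tsum_eq_sum (s := Finset.range (Nat.find h))]
    · rw [Finset.sum_congr rfl (g := fun _ => (1 : ℝ≥0∞))]
      · simp
      · intro k hk
        have : ω ∈ avoid y k := fun j hj =>
          Nat.find_min h (lt_of_le_of_lt hj (Finset.mem_range.1 hk))
        exact Set.indicator_of_mem this _
    · intro k hk
      refine Set.indicator_of_notMem (fun hc => ?_) _
      exact hc _ (not_lt.1 fun h' => hk (Finset.mem_range.2 h')) (Nat.find_spec h)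
  · push Not at h
    have h1 : hittingTime y ω = ∞ := by
      simp [hittingTime, h]
    have h2 : ∀ k, (avoid y k).indicator (1 : (ℕ → V) → ℝ≥0∞) ω = 1 := fun k =>
      Set.indicator_of_mem (show ω ∈ avoid y k from fun j _ => h j) _
    simp_rw [h1, h2]
    exact (ENNReal.tsum_const_eq_top_of_ne_zero one_ne_zero).symm

variable [MeasurableSpace V] [DiscreteMeasurableSpace V]

theorem measurableSet_avoid (y : V) (k : ℕ) : MeasurableSet (avoid y k) := by
  have : avoid y k = ⋂ j, ⋂ _ : j ≤ k, (fun ω : ℕ → V => ω j) ⁻¹' {y}ᶜ := by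
    ext ω; simp [avoid]
  rw [this]
  exact MeasurableSet.iInter fun j => MeasurableSet.iInter fun _ =>
    measurable_pi_apply j (MeasurableSet.of_discrete)

variable (G : SimpleGraph V) [DecidableRel G.Adj]

/-- The transition operator of the walk killed at `y`. -/
noncomputable def killedStep (y : V) (f : V → ℝ≥0∞) (x : V) : ℝ≥0∞ :=
  if x = y then 0 else ∫⁻ z, f z ∂(stepKernel G x)

/-- Integrating out the last step replaces `g`, cut off at `y`, by its one-step mean; hence `g`
varies in the induction. -/
theorem lintegral_avoid (x y : V) (k : ℕ) (g : V → ℝ≥0∞) :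
    ∫⁻ ω, (avoid y k).indicator 1 ω * g (ω k) ∂(walkLaw G x) =
      (killedStep G y)^[k] (fun z => if z = y then 0 else g z) x := by
  induction k generalizing g with
  | zero =>
    rw [Function.iterate_zero, id,
      ← lintegral_walkLaw_zero G x fun z => if z = y then 0 else g z]
    refine lintegral_congr fun ω => ?_
    by_cases h : ω 0 = y <;> simp [avoid, h, Set.indicator]
  | succ k ih =>
    have hS : MeasurableSet {p : (i : Finset.Iic k) → V | ∀ i, p i ≠ y} := by
      have : {p : (i : Finset.Iic k) → V | ∀ i, p i ≠ y} = ⋂ i, (fun p => p i) ⁻¹' {y}ᶜ := by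
        ext; simp
      rw [this]
      exact MeasurableSet.iInter fun i => measurable_pi_apply i (MeasurableSet.of_discrete)
    have hr : ∀ ω : ℕ → V, (avoid y k).indicator (1 : (ℕ → V) → ℝ≥0∞) ω =
        {p : (i : Finset.Iic k) → V | ∀ i, p i ≠ y}.indicator 1 (Preorder.frestrictLe k ω) := by
      intro ω
      by_cases h : ω ∈ avoid y k
      · have h' : Preorder.frestrictLe k ω ∈ {p : (i : Finset.Iic k) → V | ∀ i, p i ≠ y} :=
          fun i => h i (Finset.mem_Iic.1 i.2)
        rw [Set.indicator_of_mem h, Set.indicator_of_mem h']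
        rfl
      · have h' : Preorder.frestrictLe k ω ∉ {p : (i : Finset.Iic k) → V | ∀ i, p i ≠ y} :=
          fun hc => h fun j hj => hc ⟨j, Finset.mem_Iic.2 hj⟩
        rw [Set.indicator_of_notMem h, Set.indicator_of_notMem h']
    calc ∫⁻ ω, (avoid y (k + 1)).indicator 1 ω * g (ω (k + 1)) ∂(walkLaw G x)
        = ∫⁻ ω, {p : (i : Finset.Iic k) → V | ∀ i, p i ≠ y}.indicator 1 (Preorder.frestrictLe k ω)
            * (fun z => if z = y then 0 else g z) (ω (k + 1)) ∂(walkLaw G x) := by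
          refine lintegral_congr fun ω => ?_
          rw [← hr]
          by_cases h : ω (k + 1) = y
          · have : ω ∉ avoid y (k + 1) := fun hc => hc _ le_rfl h
            simp [this, h]
          · have this : ω ∈ avoid y (k + 1) ↔ ω ∈ avoid y k := by
              refine ⟨fun hc j hj => hc j (hj.trans (Nat.le_succ k)), fun hc j hj => ?_⟩
              rcases Nat.le_succ_iff.1 hj with hj | rfl
              exacts [hc j hj, h]
            by_cases h' : ω ∈ avoid y k <;> simp [this, h, h']
      _ = ∫⁻ ω, (avoid y k).indicator 1 ω * (fun v => ∫⁻ z, (if z = y then 0 else g z)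
            ∂(stepKernel G v)) (ω k) ∂(walkLaw G x) := by
          rw [lintegral_walkLaw_succ G x k (measurable_one.indicator hS)
            (fun z => if z = y then 0 else g z)]
          exact lintegral_congr fun ω => by rw [hr]
      _ = _ := by
          rw [ih fun v => ∫⁻ z, (if z = y then 0 else g z) ∂(stepKernel G v), Function.iterate_succ_apply]; rfl

theorem expectedHittingTime_eq_tsum (x y : V) :
    expectedHittingTime G x y =
      ∑' k, (killedStep G y)^[k] (fun z => if z = y then 0 else 1) x := by
  simp_rw [expectedHittingTime, hittingTime_eq_tsum]
  rw [lintegral_tsum fun k => (measurable_one.indicator (measurableSet_avoid y k)).aemeasurable]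
  refine tsum_congr fun k => ?_
  rw [← lintegral_avoid]
  simp

theorem killedStep_tsum (y : V) (f : ℕ → V → ℝ≥0∞) (x : V) :
    killedStep G y (fun z => ∑' k, f k z) x = ∑' k, killedStep G y (f k) x := by
  by_cases h : x = y
  · simp [killedStep, h]
  · simp only [killedStep, if_neg h]
    exact lintegral_tsum fun k => Measurable.of_discrete.aemeasurable

theorem expectedHittingTime_self (y : V) : expectedHittingTime G y y = 0 := by
  rw [expectedHittingTime_eq_tsum, ENNReal.tsum_eq_zero]
  rintro (_ | k)
  · simp
  · simp [Function.iterate_succ_apply', killedStep]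

/-- First-step analysis. -/
theorem expectedHittingTime_eq_add {x y : V} (h : x ≠ y) :
    expectedHittingTime G x y = 1 + ∫⁻ z, expectedHittingTime G z y ∂(stepKernel G x) := by
  rw [expectedHittingTime_eq_tsum, tsum_eq_zero_add' ENNReal.summable]
  congr 1
  · simp [h]
  · simp_rw [Function.iterate_succ_apply', ← killedStep_tsum, ← expectedHittingTime_eq_tsum]
    rw [killedStep, if_neg h]

/-- Minimality among supersolutions of the first-step equation: `f` dominates every partial sum of
the tail series, by induction on the number of terms. -/
theorem expectedHittingTime_le {y : V} {f : V → ℝ≥0∞}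
    (hf : ∀ x ≠ y, 1 + ∫⁻ z, f z ∂(stepKernel G x) ≤ f x) (x : V) :
    expectedHittingTime G x y ≤ f x := by
  rw [expectedHittingTime_eq_tsum, ENNReal.tsum_eq_iSup_nat]
  refine iSup_le fun n => ?_
  induction n generalizing x with
  | zero => simp
  | succ n ih =>
    -- At `y` itself `hf` gives nothing, but there every term of the series vanishes.
    by_cases h : x = y
    · subst h
      refine le_of_eq_of_le (Finset.sum_eq_zero fun k _ => ?_) (zero_le)
      cases k <;> simp [Function.iterate_succ_apply', killedStep]
    · refine le_trans ?_ (hf x h)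
      rw [Finset.sum_range_succ', add_comm]
      refine add_le_add (by simp [h]) ?_
      simp_rw [Function.iterate_succ_apply', killedStep, if_neg h]
      rw [← lintegral_finsetSum _ fun k _ => Measurable.of_discrete]
      exact lintegral_mono fun z => ih z

end Hitting

end UnicyclicWalk

namespace UnicyclicWalk

/-! ### The graph Laplacian -/

section Laplacian

variable {V : Type*} [Fintype V] [DecidableEq V] (G : SimpleGraph V) [DecidableRel G.Adj]

/-- The graph Laplacian `L f (v) = ∑_{w ∼ v} (f v - f w)`. -/
def laplacian : (V → ℝ) →ₗ[ℝ] (V → ℝ) where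
  toFun f v := ∑ w ∈ G.neighborFinset v, (f v - f w)
  map_add' f g := by
    ext v
    simp only [Pi.add_apply, ← Finset.sum_add_distrib]
    exact Finset.sum_congr rfl fun w _ => by ring
  map_smul' c f := by
    ext v
    simp only [Pi.smul_apply, smul_eq_mul, RingHom.id_apply, Finset.mul_sum]
    exact Finset.sum_congr rfl fun w _ => by ring

theorem laplacian_apply (f : V → ℝ) (v : V) :
    laplacian G f v = ∑ w ∈ G.neighborFinset v, (f v - f w) := rfl

theorem laplacian_eq (f : V → ℝ) (v : V) :
    laplacian G f v = G.degree v * f v - ∑ w ∈ G.neighborFinset v, f w := by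
  rw [laplacian_apply, Finset.sum_sub_distrib, Finset.sum_const,
    SimpleGraph.card_neighborFinset_eq_degree, nsmul_eq_mul]

theorem laplacian_add_const (f : V → ℝ) (c : ℝ) :
    laplacian G (fun v => f v + c) = laplacian G f := by
  ext v
  simp only [laplacian_apply, add_sub_add_right_eq_sub]

/-- Each edge contributes opposite amounts at its two ends, so the sum equals its own negative. -/
theorem sum_laplacian (f : V → ℝ) : ∑ v, laplacian G f v = 0 := by
  have h : ∀ v, laplacian G f v = ∑ w, if G.Adj v w then f v - f w else 0 := fun v => by
    rw [laplacian_apply, ← Finset.sum_filter, SimpleGraph.neighborFinset_eq_filter]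
  have h' : ∑ v, laplacian G f v = -∑ v, laplacian G f v := by
    simp_rw [h]
    conv_rhs => rw [Finset.sum_comm]
    simp_rw [← Finset.sum_neg_distrib]
    refine Finset.sum_congr rfl fun v _ => Finset.sum_congr rfl fun w _ => ?_
    by_cases hvw : G.Adj v w
    · rw [if_pos hvw, if_pos hvw.symm]; ring
    · rw [if_neg hvw, if_neg fun h => hvw h.symm, neg_zero]
  linarith

variable {G}

/-- Harmonic functions on a connected finite graph are constant. -/
theorem eq_of_laplacian_eq_zero (hG : G.Connected) {f : V → ℝ} (hf : laplacian G f = 0) (v w : V) :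
    f v = f w := by
  refine (SimpleGraph.lapMatrix_mulVec_eq_zero_iff_forall_reachable G).1 ?_ v w (hG v w)
  ext u
  rw [SimpleGraph.lapMatrix_mulVec_apply, ← laplacian_eq, hf]

/-- The value at `y` is forced, because the Laplacian sums to zero and the degrees sum to twice the
number of edges. -/
theorem laplacian_apply_eq_of_forall_ne {f : V → ℝ} {y : V}
    (hf : ∀ v ≠ y, laplacian G f v = G.degree v) (v : V) :
    laplacian G f v = G.degree v - if v = y then 2 * (G.edgeFinset.card : ℝ) else 0 := by
  by_cases h : v = y
  · subst h
    have h1 := sum_laplacian G f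
    have h2 : ∑ v, (G.degree v : ℝ) = 2 * (G.edgeFinset.card : ℝ) := by
      exact_mod_cast G.sum_degrees_eq_twice_card_edges
    rw [← Finset.add_sum_erase _ _ (Finset.mem_univ v)] at h1 h2
    rw [Finset.sum_congr rfl fun w hw => hf w (Finset.ne_of_mem_erase hw)] at h1
    rw [if_pos rfl]
    linarith
  · rw [hf v h, if_neg h, sub_zero]

/-- On a connected graph, the Laplacian can be prescribed off a given vertex. -/
theorem exists_laplacian_eq_of_ne (hG : G.Connected) (y : V) (b : V → ℝ) :
    ∃ f : V → ℝ, ∀ v ≠ y, laplacian G f v = b v := by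
  -- Grounding at `y` makes the Laplacian injective: a kernel element is harmonic off `y`, hence
  -- everywhere, hence constant, and it vanishes at `y`. Finite dimension then gives surjectivity.
  let T : (V → ℝ) →ₗ[ℝ] (V → ℝ) :=
    { toFun := fun f v => if v = y then f y else laplacian G f v
      map_add' := fun f g => by ext v; by_cases h : v = y <;> simp [h]
      map_smul' := fun c f => by ext v; by_cases h : v = y <;> simp [h] }
  have hT : ∀ f v, T f v = if v = y then f y else laplacian G f v := fun _ _ => rfl
  have hinj : Function.Injective T := by
    rw [← LinearMap.ker_eq_bot, LinearMap.ker_eq_bot']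
    intro f hf
    have hfy : f y = 0 := by simpa [hT] using congrFun hf y
    have hne : ∀ v ≠ y, laplacian G f v = 0 := fun v hv => by
      simpa [hT, hv] using congrFun hf v
    have hL : laplacian G f = 0 := by
      ext v
      by_cases h : v = y
      · subst h
        have h1 := sum_laplacian G f
        rwa [← Finset.add_sum_erase _ _ (Finset.mem_univ v),
          Finset.sum_eq_zero fun w hw => hne w (Finset.ne_of_mem_erase hw), add_zero] at h1
      · exact hne v h
    ext v
    rw [eq_of_laplacian_eq_zero hG hL v y, hfy]
    rfl
  obtain ⟨f, hf⟩ := LinearMap.injective_iff_surjective.1 hinj b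
  exact ⟨f, fun v hv => by rw [← hf, hT, if_neg hv]⟩

end Laplacian

/-! ### Hitting times as potentials -/

section Potential

variable {V : Type*} [Fintype V] [DecidableEq V] [MeasurableSpace V] [DiscreteMeasurableSpace V]
  {G : SimpleGraph V} [DecidableRel G.Adj]

theorem neighborFinset_nonempty_of_ne (hG : G.Connected) {x y : V} (h : x ≠ y) :
    (G.neighborFinset x).Nonempty := by
  have : Nontrivial V := ⟨x, y, h⟩
  obtain ⟨w, hw⟩ := hG.preconnected.exists_adj_of_nontrivial x
  exact ⟨w, by simpa using hw⟩

/-- A real solution of the first-step equation, shifted by a constant to be nonnegative, is a finite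
supersolution. -/
theorem expectedHittingTime_ne_top (hG : G.Connected) (x y : V) :
    expectedHittingTime G x y ≠ ∞ := by
  obtain ⟨f₀, hf₀⟩ := exists_laplacian_eq_of_ne hG y fun v => G.degree v
  obtain ⟨f, hc, hf⟩ : ∃ f : V → ℝ, (∀ v, 0 ≤ f v) ∧ ∀ v ≠ y, laplacian G f v = G.degree v := by
    obtain ⟨c, hc⟩ := (Set.finite_range fun v => -f₀ v).bddAbove
    refine ⟨fun v => f₀ v + c, fun v => ?_, by rwa [laplacian_add_const]⟩
    have : -f₀ v ≤ c := hc ⟨v, rfl⟩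
    linarith
  refine ne_top_of_le_ne_top ENNReal.ofReal_ne_top
    (expectedHittingTime_le G (f := fun v => ENNReal.ofReal (f v)) (fun v hv => ?_) x)
  have hN := neighborFinset_nonempty_of_ne hG hv
  have hd : 0 < (G.degree v : ℝ) := by
    rw [← SimpleGraph.card_neighborFinset_eq_degree]
    exact_mod_cast hN.card_pos
  have h := hf v hv
  rw [laplacian_eq] at h
  rw [lintegral_stepKernel G hN, ← Finset.mul_sum, ← ENNReal.ofReal_sum_of_nonneg fun w _ => hc w,
    ← ENNReal.ofReal_natCast, ← ENNReal.ofReal_inv_of_pos hd,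
    ← ENNReal.ofReal_mul (by positivity), ← ENNReal.ofReal_one,
    ← ENNReal.ofReal_add zero_le_one
      (mul_nonneg (by positivity) (Finset.sum_nonneg fun w _ => hc w))]
  refine ENNReal.ofReal_le_ofReal (le_of_eq ?_)
  field_simp
  linarith

theorem laplacian_expectedHittingTime (hG : G.Connected) (y v : V) :
    laplacian G (fun u => (expectedHittingTime G u y).toReal) v =
      G.degree v - if v = y then 2 * (G.edgeFinset.card : ℝ) else 0 := by
  refine laplacian_apply_eq_of_forall_ne (fun v hv => ?_) v
  have hN := neighborFinset_nonempty_of_ne hG hv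
  have hd : 0 < (G.degree v : ℝ) := by
    rw [← SimpleGraph.card_neighborFinset_eq_degree]
    exact_mod_cast hN.card_pos
  have hfin := fun w => expectedHittingTime_ne_top hG w y
  have hs : ∑ w ∈ G.neighborFinset v, expectedHittingTime G w y ≠ ∞ :=
    ENNReal.sum_ne_top.2 fun w _ => hfin w
  rw [laplacian_eq, expectedHittingTime_eq_add G hv, lintegral_stepKernel G hN, ← Finset.mul_sum,
    ENNReal.toReal_add ENNReal.one_ne_top, ENNReal.toReal_mul, ENNReal.toReal_inv,
    ENNReal.toReal_sum fun w _ => hfin w, ENNReal.toReal_one, ENNReal.toReal_natCast]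
  · field_simp
    ring
  · exact ENNReal.mul_ne_top (ENNReal.inv_ne_top.2 (by exact_mod_cast hd.ne')) hs

/-- The commute time identity. -/
theorem expectedHittingTime_add_comm_eq (hG : G.Connected) (hm : G.edgeFinset.card ≠ 0) (x y : V) :
    (expectedHittingTime G x y).toReal + (expectedHittingTime G y x).toReal =
      2 * (G.edgeFinset.card : ℝ) * resistanceDist G x y := by
  have hm' : (G.edgeFinset.card : ℝ) ≠ 0 := by exact_mod_cast hm
  set H : V → V → ℝ := fun u w => (expectedHittingTime G u w).toReal with hH
  -- The degree terms of the two Laplacians cancel, leaving `2m` times the unit source at `x` minus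
  -- the unit sink at `y`.
  let f₀ : V → ℝ := (2 * (G.edgeFinset.card : ℝ))⁻¹ • ((fun u => H u y) - fun u => H u x)
  have hf₀ : ∀ v, laplacian G f₀ v = (if v = x then 1 else 0) - (if v = y then 1 else 0) := by
    intro v
    simp only [f₀, map_smul, map_sub, Pi.smul_apply, Pi.sub_apply, smul_eq_mul, hH,
      laplacian_expectedHittingTime hG]
    split_ifs <;> field_simp <;> ring
  -- Two unit-current potentials differ by a harmonic, hence constant, function, so the set under
  -- `sInf` is a singleton.
  have hset : {t | ∃ f : V → ℝ, IsUnitCurrentPotential G x y f ∧ t = f x - f y} =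
      {f₀ x - f₀ y} := by
    ext t
    constructor
    · rintro ⟨f, hf, rfl⟩
      have h0 : laplacian G (f - f₀) = 0 := by
        ext v
        rw [map_sub, Pi.sub_apply, hf₀, laplacian_apply, hf v, sub_self]
        rfl
      have := eq_of_laplacian_eq_zero hG h0 x y
      simp only [Pi.sub_apply] at this
      rw [Set.mem_singleton_iff]
      linarith
    · rintro rfl
      exact ⟨f₀, hf₀, rfl⟩
  have hself : ∀ u, H u u = 0 := fun u => by simp [hH, expectedHittingTime_self]
  rw [resistanceDist, hset, csInf_singleton]
  change H x y + H y x = _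
  simp only [f₀, Pi.smul_apply, Pi.sub_apply, smul_eq_mul, hself]
  field_simp
  ring

theorem coverCost_ne_top (hG : G.Connected) (x : V) : coverCost G x ≠ ∞ :=
  ENNReal.sum_ne_top.2 fun y _ => expectedHittingTime_ne_top hG x y

theorem reverseCoverCost_ne_top (hG : G.Connected) (x : V) : reverseCoverCost G x ≠ ∞ :=
  ENNReal.sum_ne_top.2 fun y _ => expectedHittingTime_ne_top hG y x

theorem toReal_coverCost (hG : G.Connected) (x : V) :
    (coverCost G x).toReal = ∑ y, (expectedHittingTime G x y).toReal :=
  ENNReal.toReal_sum fun y _ => expectedHittingTime_ne_top hG x y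

theorem toReal_reverseCoverCost (hG : G.Connected) (x : V) :
    (reverseCoverCost G x).toReal = ∑ y, (expectedHittingTime G y x).toReal :=
  ENNReal.toReal_sum fun y _ => expectedHittingTime_ne_top hG y x

theorem coverCost_add_reverseCoverCost (hG : G.Connected) (hm : G.edgeFinset.card ≠ 0) (x : V) :
    (coverCost G x).toReal + (reverseCoverCost G x).toReal =
      2 * (G.edgeFinset.card : ℝ) * resistanceCentrality G x := by
  rw [toReal_coverCost hG, toReal_reverseCoverCost hG, ← Finset.sum_add_distrib,
    resistanceCentrality, Finset.mul_sum]
  exact Finset.sum_congr rfl fun y _ => expectedHittingTime_add_comm_eq hG hm x y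

theorem laplacian_coverCost (hG : G.Connected) (v : V) :
    laplacian G (fun u => (coverCost G u).toReal) v =
      Fintype.card V * G.degree v - 2 * (G.edgeFinset.card : ℝ) := by
  have h : (fun u => (coverCost G u).toReal) =
      ∑ y, fun u => (expectedHittingTime G u y).toReal := by
    ext u
    rw [toReal_coverCost hG, Finset.sum_apply]
  rw [h, map_sum, Finset.sum_apply]
  simp_rw [laplacian_expectedHittingTime hG]
  simp [Finset.sum_sub_distrib]

end Potential

/-! ### The Kirchhoff index and the total cover cost -/

section Kirchhoff

variable {V : Type*} [Fintype V] [DecidableEq V]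

theorem sum_sym2_not_isDiag (f : V → V → ℝ) (hf : ∀ a b, f a b = f b a) (h0 : ∀ a, f a a = 0) :
    2 * ∑ p : Sym2 V with ¬ p.IsDiag, Sym2.lift ⟨f, hf⟩ p = ∑ a, ∑ b, f a b := by
  have h1 : ∑ a, ∑ b, f a b = ∑ q : V × V with ¬ (s(q.1, q.2)).IsDiag, f q.1 q.2 := by
    rw [← Finset.sum_product', Finset.univ_product_univ]
    rw [Finset.sum_filter]
    refine Finset.sum_congr rfl fun q _ => ?_
    split_ifs with hd
    · rw [Sym2.mk_isDiag_iff] at hd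
      rw [hd, h0]
    · rfl
  rw [h1, Finset.mul_sum, ← Finset.sum_fiberwise_of_maps_to
    (s := Finset.univ.filter fun q : V × V => ¬ (s(q.1, q.2)).IsDiag)
    (t := Finset.univ.filter fun p : Sym2 V => ¬ p.IsDiag) (g := fun q => s(q.1, q.2))
    (fun q hq => by simpa using hq)]
  refine Finset.sum_congr rfl fun p hp => ?_
  induction p with | _ a b
  have hab : a ≠ b := by simpa using hp
  have : ((Finset.univ.filter fun q : V × V => ¬ (s(q.1, q.2)).IsDiag).filter
      fun q => s(q.1, q.2) = s(a, b)) = {(a, b), (b, a)} := by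
    ext ⟨c, d⟩
    simp only [Finset.mem_filter, Finset.mem_univ, true_and, Finset.mem_insert,
      Finset.mem_singleton, Prod.mk.injEq, Sym2.eq_iff, Sym2.mk_isDiag_iff]
    refine ⟨fun h => h.2, fun h => ⟨?_, h⟩⟩
    rintro rfl
    rcases h with ⟨rfl, rfl⟩ | ⟨rfl, rfl⟩ <;> exact hab rfl
  rw [this, Finset.sum_pair (by simp [hab]), hf b a, Sym2.lift_mk]
  ring

variable {G : SimpleGraph V} [DecidableRel G.Adj]

theorem two_mul_kirchhoffIndex (h : ∀ x, resistanceDist G x x = 0) :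
    2 * kirchhoffIndex G = ∑ x, resistanceCentrality G x :=
  sum_sym2_not_isDiag _ (resistanceDist_comm G) h

variable [MeasurableSpace V] [DiscreteMeasurableSpace V]

/-- Cover costs and reverse cover costs have the same total, the sum of `H` over all ordered pairs;
the commute time identity evaluates twice this total. -/
theorem sum_coverCost (hG : G.Connected) (hm : G.edgeFinset.card ≠ 0) :
    ∑ x, (coverCost G x).toReal = 2 * (G.edgeFinset.card : ℝ) * kirchhoffIndex G := by
  have hm' : (G.edgeFinset.card : ℝ) ≠ 0 := by exact_mod_cast hm
  have h0 : ∀ x, resistanceDist G x x = 0 := fun x => by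
    have := expectedHittingTime_add_comm_eq hG hm x x
    simpa [expectedHittingTime_self, hm'] using this
  have h1 : ∑ x, (reverseCoverCost G x).toReal = ∑ x, (coverCost G x).toReal := by
    simp_rw [toReal_coverCost hG, toReal_reverseCoverCost hG]
    exact Finset.sum_comm
  have h2 : ∑ x, ((coverCost G x).toReal + (reverseCoverCost G x).toReal) =
      2 * (G.edgeFinset.card : ℝ) * (2 * kirchhoffIndex G) := by
    rw [two_mul_kirchhoffIndex h0, Finset.mul_sum]
    exact Finset.sum_congr rfl fun x _ => coverCost_add_reverseCoverCost hG hm x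
  rw [Finset.sum_add_distrib, h1] at h2
  linarith

end Kirchhoff

end UnicyclicWalk

namespace UnicyclicWalk

/-! ### Distance to the cycle of a unicyclic graph -/

section Cycle

open SimpleGraph

variable {V : Type*} {G : SimpleGraph V} {l : ℕ} (v : (cycleGraph l).Copy G)

/-- The distance from a vertex to the cycle. -/
noncomputable def cycleDist (z : V) : ℕ := ⨅ i, G.dist z (v i)

theorem cycleDist_le (z : V) (i : Fin l) : cycleDist v z ≤ G.dist z (v i) :=
  ciInf_le (OrderBot.bddBelow _) i

theorem exists_dist_eq_cycleDist (hl : 3 ≤ l) (z : V) : ∃ i, G.dist z (v i) = cycleDist v z := by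
  have : Nonempty (Fin l) := ⟨⟨0, by lia⟩⟩
  exact ciInf_mem fun i => G.dist z (v i)

theorem cycleDist_apply (i : Fin l) : cycleDist v (v i) = 0 :=
  Nat.le_zero.1 ((cycleDist_le v _ i).trans_eq dist_self)

variable {v}

theorem cycleDist_eq_zero_iff (hG : G.Connected) (hl : 3 ≤ l) {z : V} :
    cycleDist v z = 0 ↔ ∃ i, v i = z := by
  constructor
  · intro h
    obtain ⟨i, hi⟩ := exists_dist_eq_cycleDist v hl z
    exact ⟨i, ((hG z (v i)).dist_eq_zero_iff.1 (hi.trans h)).symm⟩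
  · rintro ⟨i, rfl⟩
    exact cycleDist_apply v i

/-- The second vertex of a geodesic from `z` to a nearest cycle vertex works; the triangle
inequality excludes a larger drop. -/
theorem exists_adj_cycleDist (hG : G.Connected) (hl : 3 ≤ l) {z : V} (hz : cycleDist v z ≠ 0) :
    ∃ w, G.Adj z w ∧ cycleDist v w + 1 = cycleDist v z := by
  obtain ⟨i, hi⟩ := exists_dist_eq_cycleDist v hl z
  obtain ⟨q, hq⟩ := hG.exists_walk_length_eq_dist z (v i)
  rw [hi] at hq
  cases q with
  | nil => exact absurd hq.symm hz
  | @cons _ w _ h q =>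
    refine ⟨w, h, ?_⟩
    rw [Walk.length_cons] at hq
    have h1 := (cycleDist_le v w i).trans (dist_le q)
    obtain ⟨j, hj⟩ := exists_dist_eq_cycleDist v hl w
    have h2 := cycleDist_le v z j
    have h3 := hG.dist_triangle (u := z) (v := w) (w := v j)
    have h4 : G.dist z w = 1 := dist_eq_one_iff_adj.2 h
    lia

open Classical in
variable (v) in
/-- A neighbour of `z` that is closer to the cycle. -/
noncomputable def cycleParent (z : V) : V :=
  if h : ∃ w, G.Adj z w ∧ cycleDist v w + 1 = cycleDist v z then h.choose else z

theorem adj_cycleParent (hG : G.Connected) (hl : 3 ≤ l) {z : V} (hz : cycleDist v z ≠ 0) :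
    G.Adj z (cycleParent v z) := by
  have h := exists_adj_cycleDist hG hl hz
  rw [cycleParent, dif_pos h]
  exact h.choose_spec.1

theorem cycleDist_cycleParent (hG : G.Connected) (hl : 3 ≤ l) {z : V} (hz : cycleDist v z ≠ 0) :
    cycleDist v (cycleParent v z) + 1 = cycleDist v z := by
  have h := exists_adj_cycleDist hG hl hz
  rw [cycleParent, dif_pos h]
  exact h.choose_spec.2

theorem degree_cycleGraph (hl : 3 ≤ l) (i : Fin l) : (cycleGraph l).degree i = 2 := by
  obtain ⟨m, rfl⟩ : ∃ m, l = m + 3 := ⟨l - 3, by lia⟩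
  exact cycleGraph_degree_three_le

theorem card_edgeFinset_cycleGraph (hl : 3 ≤ l) : (cycleGraph l).edgeFinset.card = l := by
  have h := (cycleGraph l).sum_degrees_eq_twice_card_edges
  simp_rw [degree_cycleGraph hl] at h
  simp at h
  lia

/-- In a unicyclic graph, each edge lies on the cycle or leads from a vertex to its parent. -/
theorem adj_cases [Fintype V] [DecidableEq V] [DecidableRel G.Adj] (hG : G.Connected) (hl : 3 ≤ l)
    (hcard : Fintype.card V = G.edgeFinset.card) {a b : V} (hab : G.Adj a b) :
    (∃ i j, (cycleGraph l).Adj i j ∧ v i = a ∧ v j = b) ∨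
      (cycleDist v a ≠ 0 ∧ cycleParent v a = b) ∨ (cycleDist v b ≠ 0 ∧ cycleParent v b = a) := by
  classical
  -- There are `l` cycle edges and one parent edge for each of the `n - l` vertices off the cycle.
  -- These `n` edges are distinct, so they are all the edges of `G`.
  set E₁ : Finset (Sym2 V) := (cycleGraph l).edgeFinset.image (Sym2.map v) with hE₁
  set N : Finset V := Finset.univ.filter fun z => cycleDist v z ≠ 0 with hN
  set E₂ : Finset (Sym2 V) := N.image fun z => s(z, cycleParent v z) with hE₂
  have hv : Function.Injective v := v.injective
  have c₁ : E₁.card = l := by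
    rw [hE₁, Finset.card_image_of_injective _ (Sym2.map.injective hv),
      card_edgeFinset_cycleGraph hl]
  have cN : l + N.card = Fintype.card V := by
    have h0 : (Finset.univ.filter fun z => cycleDist v z = 0) = Finset.univ.image v := by
      ext z
      simp [cycleDist_eq_zero_iff hG hl]
    have h1 := Finset.card_filter_add_card_filter_not (s := (Finset.univ : Finset V))
      (fun z => cycleDist v z = 0)
    rwa [h0, Finset.card_image_of_injective _ hv, Finset.card_univ, Fintype.card_fin,
      Finset.card_univ] at h1
  have c₂ : E₂.card = N.card := by
    refine Finset.card_image_of_injOn fun z hz w hw h => ?_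
    have hz' : cycleDist v z ≠ 0 := by simpa [hN] using hz
    have hw' : cycleDist v w ≠ 0 := by simpa [hN] using hw
    have h1 := cycleDist_cycleParent hG hl hz'
    have h2 := cycleDist_cycleParent hG hl hw'
    -- Two vertices cannot be each other's parents, as each would be strictly closer to the cycle
    -- than the other.
    rcases Sym2.eq_iff.1 h with ⟨h, -⟩ | ⟨h3, h4⟩
    · exact h
    · rw [← h3] at h2
      rw [h4] at h1
      lia
  have hdisj : Disjoint E₁ E₂ := by
    rw [Finset.disjoint_left]
    intro e h1 h2
    obtain ⟨z, hz, rfl⟩ := Finset.mem_image.1 h2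
    obtain ⟨e, -, he⟩ := Finset.mem_image.1 h1
    have hz' : cycleDist v z ≠ 0 := by simpa [hN] using hz
    have : z ∈ Sym2.map v e := he ▸ Sym2.mem_mk_left _ _
    obtain ⟨i, -, rfl⟩ := Sym2.mem_map.1 this
    exact hz' (cycleDist_apply v i)
  have hsub : E₁ ∪ E₂ ⊆ G.edgeFinset := by
    refine Finset.union_subset (fun e he => ?_) fun e he => ?_
    · obtain ⟨e', he', rfl⟩ := Finset.mem_image.1 he
      clear he
      induction e' with | _ i j
      rw [mem_edgeFinset, mem_edgeSet] at he'
      rw [mem_edgeFinset, Sym2.map_mk, mem_edgeSet]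
      exact v.toHom.map_adj he'
    · obtain ⟨z, hz, rfl⟩ := Finset.mem_image.1 he
      have hz' : cycleDist v z ≠ 0 := by simpa [hN] using hz
      simpa using adj_cycleParent hG hl hz'
  have heq : E₁ ∪ E₂ = G.edgeFinset := by
    refine Finset.eq_of_subset_of_card_le hsub ?_
    rw [Finset.card_union_of_disjoint hdisj]
    lia
  have hmem : s(a, b) ∈ E₁ ∪ E₂ := by
    rw [heq]
    simpa using hab
  rcases Finset.mem_union.1 hmem with h | h
  · obtain ⟨e, he, h⟩ := Finset.mem_image.1 h
    induction e with | _ i j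
    have he : (cycleGraph l).Adj i j := by simpa using he
    rcases Sym2.eq_iff.1 h with ⟨h1, h2⟩ | ⟨h1, h2⟩
    exacts [Or.inl ⟨i, j, he, h1, h2⟩, Or.inl ⟨j, i, he.symm, h2, h1⟩]
  · obtain ⟨z, hz, h⟩ := Finset.mem_image.1 h
    have hz' : cycleDist v z ≠ 0 := by simpa [hN] using hz
    rcases Sym2.eq_iff.1 h with ⟨rfl, h2⟩ | ⟨rfl, h2⟩
    exacts [Or.inr (Or.inl ⟨hz', h2⟩), Or.inr (Or.inr ⟨hz', h2⟩)]

/-- The distance to the cycle of a unicyclic graph has Laplacian `2 - deg`. -/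
theorem laplacian_cycleDist [Fintype V] [DecidableEq V] [DecidableRel G.Adj] (hG : G.Connected)
    (hl : 3 ≤ l) (hcard : Fintype.card V = G.edgeFinset.card) (z : V) :
    laplacian G (fun u => (cycleDist v u : ℝ)) z = 2 - G.degree z := by
  -- `S` holds the exceptional neighbours, those not farther from the cycle than `z`: two cycle
  -- neighbours with `c = 1` (difference 0), or the parent alone with `c = 2` (difference 1). The
  -- others contribute `-1` each, so the total is `c |S| - deg z` with `c |S| = 2`.
  have key : ∀ (S : Finset V) (c : ℝ), S ⊆ G.neighborFinset z → c * S.card = 2 →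
      (∀ w ∈ G.neighborFinset z,
        (cycleDist v z : ℝ) - cycleDist v w = (if w ∈ S then c else 0) - 1) →
      laplacian G (fun u => (cycleDist v u : ℝ)) z = 2 - G.degree z := by
    intro S c hS hc h
    rw [laplacian_apply, Finset.sum_congr rfl h, Finset.sum_sub_distrib, Finset.sum_ite_mem,
      Finset.inter_eq_right.2 hS, Finset.sum_const, Finset.sum_const,
      card_neighborFinset_eq_degree, nsmul_eq_mul, nsmul_eq_mul, mul_one, mul_comm, hc]
  by_cases hz : cycleDist v z = 0
  · obtain ⟨i, rfl⟩ := (cycleDist_eq_zero_iff hG hl).1 hz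
    refine key (((cycleGraph l).neighborFinset i).image v) 1 (fun w hw => ?_) ?_ fun w hw => ?_
    · obtain ⟨j, hj, rfl⟩ := Finset.mem_image.1 hw
      rw [mem_neighborFinset] at hj ⊢
      exact v.toHom.map_adj hj
    · rw [Finset.card_image_of_injective (f := v) _ v.injective, card_neighborFinset_eq_degree,
        degree_cycleGraph hl]
      norm_num
    · rw [mem_neighborFinset] at hw
      split_ifs with h
      · obtain ⟨j, hj, rfl⟩ := Finset.mem_image.1 h
        simp [cycleDist_apply]
      · rcases adj_cases hG hl hcard hw (v := v) with ⟨a, b, hab, ha, rfl⟩ | ⟨h', -⟩ | ⟨h1, h2⟩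
        · obtain rfl := v.injective ha
          exact absurd (Finset.mem_image_of_mem v ((mem_neighborFinset _ _ _).2 hab)) h
        · exact absurd hz h'
        · have := cycleDist_cycleParent hG hl h1
          rw [h2, hz] at this
          rw [hz, ← this]
          norm_num
  · refine key {cycleParent v z} 2 ?_ (by simp) fun w hw => ?_
    · rw [Finset.singleton_subset_iff, mem_neighborFinset]
      exact adj_cycleParent hG hl hz
    · rw [mem_neighborFinset] at hw
      split_ifs with h
      · rw [Finset.mem_singleton.1 h, ← cycleDist_cycleParent hG hl hz]
        push_cast
        ring
      · rcases adj_cases hG hl hcard hw (v := v) with ⟨a, b, -, rfl, -⟩ | ⟨-, h'⟩ | ⟨h1, h2⟩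
        · exact absurd (cycleDist_apply v a) hz
        · exact absurd (Finset.mem_singleton.2 h'.symm) h
        · have := cycleDist_cycleParent hG hl h1
          rw [h2] at this
          rw [← this]
          push_cast
          ring

/-! ### The trees hanging off the cycle -/

variable (v) in
/-- The cycle vertex at which the chain of parents of `z` ends. -/
noncomputable def cycleRoot (hl : 3 ≤ l) (z : V) : Fin l :=
  haveI : Nonempty (Fin l) := ⟨⟨0, by lia⟩⟩
  Function.invFun v ((cycleParent v)^[cycleDist v z] z)

theorem cycleRoot_apply (hl : 3 ≤ l) (i : Fin l) : cycleRoot v hl (v i) = i := by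
  have : Nonempty (Fin l) := ⟨i⟩
  rw [cycleRoot, cycleDist_apply]
  exact Function.leftInverse_invFun v.injective i

theorem cycleRoot_cycleParent (hG : G.Connected) (hl : 3 ≤ l) {z : V} (hz : cycleDist v z ≠ 0) :
    cycleRoot v hl (cycleParent v z) = cycleRoot v hl z := by
  rw [cycleRoot, cycleRoot, ← cycleDist_cycleParent hG hl hz, Function.iterate_succ_apply]

theorem mem_edgeSet_toSubgraph_iff {a b : V} :
    s(a, b) ∈ v.toSubgraph.edgeSet ↔ ∃ i j, (cycleGraph l).Adj i j ∧ v i = a ∧ v j = b := by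
  rw [Subgraph.mem_edgeSet, Subgraph.map_adj]
  rfl

theorem deleteEdges_adj_cycleParent (hG : G.Connected) (hl : 3 ≤ l) {z : V}
    (hz : cycleDist v z ≠ 0) :
    (G.deleteEdges v.toSubgraph.edgeSet).Adj z (cycleParent v z) := by
  rw [deleteEdges_adj, mem_edgeSet_toSubgraph_iff]
  refine ⟨adj_cycleParent hG hl hz, ?_⟩
  rintro ⟨i, j, -, rfl, -⟩
  exact hz (cycleDist_apply v i)

theorem mem_supp_cycleTree_iff_cycleParent (hG : G.Connected) (hl : 3 ≤ l) {z : V}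
    (hz : cycleDist v z ≠ 0) (i : Fin l) :
    cycleParent v z ∈ (cycleTree G v i).supp ↔ z ∈ (cycleTree G v i).supp :=
  (ConnectedComponent.mem_supp_congr_adj _ (deleteEdges_adj_cycleParent hG hl hz)).symm

theorem mem_supp_cycleTree_cycleRoot (hG : G.Connected) (hl : 3 ≤ l) (z : V) :
    z ∈ (cycleTree G v (cycleRoot v hl z)).supp := by
  induction hn : cycleDist v z generalizing z with
  | zero =>
    obtain ⟨i, rfl⟩ := (cycleDist_eq_zero_iff hG hl).1 hn
    rw [cycleRoot_apply]
    exact ConnectedComponent.connectedComponentMk_mem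
  | succ n ih =>
    have hz : cycleDist v z ≠ 0 := by lia
    have := cycleDist_cycleParent hG hl hz
    rw [← mem_supp_cycleTree_iff_cycleParent hG hl hz, ← cycleRoot_cycleParent hG hl hz]
    exact ih _ (by lia)

/-- The chain of parents read backwards; parent edges survive the deletion of the cycle. This bounds
the distance above both in the tree and in `G`. -/
theorem exists_walk_cycleTree (hG : G.Connected) (hl : 3 ≤ l) {z : V} {i : Fin l}
    (hz : z ∈ (cycleTree G v i).supp) (hr : cycleRoot v hl z = i) :
    ∃ q : (cycleTree G v i).toSimpleGraph.Walk
      ⟨v i, ConnectedComponent.connectedComponentMk_mem⟩ ⟨z, hz⟩, q.length = cycleDist v z := by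
  induction hn : cycleDist v z generalizing z with
  | zero =>
    obtain ⟨j, rfl⟩ := (cycleDist_eq_zero_iff hG hl).1 hn
    rw [cycleRoot_apply] at hr
    subst hr
    exact ⟨Walk.nil, rfl⟩
  | succ n ih =>
    have hz0 : cycleDist v z ≠ 0 := by lia
    have hd := cycleDist_cycleParent hG hl hz0
    have hp := (mem_supp_cycleTree_iff_cycleParent hG hl hz0 i).2 hz
    obtain ⟨q, hq⟩ := ih hp ((cycleRoot_cycleParent hG hl hz0).trans hr) (by lia)
    refine ⟨q.concat ?_, by rw [Walk.length_concat, hq]⟩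
    exact (ConnectedComponent.toSimpleGraph_adj _ hp hz).2
      (deleteEdges_adj_cycleParent hG hl hz0).symm

variable [Fintype V] [DecidableEq V] [DecidableRel G.Adj]

/-- By `adj_cases` only parent edges remain once the cycle is deleted, and the root is constant
along them. -/
theorem mem_supp_cycleTree_iff (hG : G.Connected) (hl : 3 ≤ l)
    (hcard : Fintype.card V = G.edgeFinset.card) {z : V} {i : Fin l} :
    z ∈ (cycleTree G v i).supp ↔ cycleRoot v hl z = i := by
  constructor
  · intro hz
    have hr : (G.deleteEdges v.toSubgraph.edgeSet).Reachable z (v i) :=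
      ConnectedComponent.exact hz
    obtain ⟨q⟩ := hr
    have : ∀ {a b : V}, (G.deleteEdges v.toSubgraph.edgeSet).Walk a b →
        cycleRoot v hl a = cycleRoot v hl b := by
      intro a b q
      induction q with
      | nil => rfl
      | cons h _ ih =>
        rw [← ih]
        rw [deleteEdges_adj, mem_edgeSet_toSubgraph_iff] at h
        rcases adj_cases hG hl hcard h.1 (v := v) with h' | ⟨h1, rfl⟩ | ⟨h1, rfl⟩
        · exact absurd h' h.2
        · exact (cycleRoot_cycleParent hG hl h1).symm
        · exact cycleRoot_cycleParent hG hl h1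
    rw [this q, cycleRoot_apply]
  · rintro rfl
    exact mem_supp_cycleTree_cycleRoot hG hl z

theorem dist_eq_cycleDist (hG : G.Connected) (hl : 3 ≤ l)
    (hcard : Fintype.card V = G.edgeFinset.card) {z : V} {i : Fin l}
    (hz : z ∈ (cycleTree G v i).supp) : G.dist z (v i) = cycleDist v z := by
  obtain ⟨q, hq⟩ := exists_walk_cycleTree hG hl hz ((mem_supp_cycleTree_iff hG hl hcard).1 hz)
  refine le_antisymm ?_ (cycleDist_le v z i)
  have := dist_le ((q.map (cycleTree G v i).toSimpleGraph_hom).map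
    (Hom.ofLE (deleteEdges_le v.toSubgraph.edgeSet)))
  rw [Walk.length_map, Walk.length_map, hq] at this
  rw [dist_comm]
  exact this

theorem dist_toSimpleGraph_cycleTree (hG : G.Connected) (hl : 3 ≤ l)
    (hcard : Fintype.card V = G.edgeFinset.card) {z : V} {i : Fin l}
    (hz : z ∈ (cycleTree G v i).supp) :
    (cycleTree G v i).toSimpleGraph.dist
      ⟨v i, ConnectedComponent.connectedComponentMk_mem⟩ ⟨z, hz⟩ = cycleDist v z := by
  obtain ⟨q, hq⟩ := exists_walk_cycleTree hG hl hz ((mem_supp_cycleTree_iff hG hl hcard).1 hz)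
  refine le_antisymm (hq ▸ dist_le q) ?_
  obtain ⟨q', hq'⟩ := q.reachable.exists_walk_length_eq_dist
  have := dist_le ((q'.map (cycleTree G v i).toSimpleGraph_hom).map
    (Hom.ofLE (deleteEdges_le v.toSubgraph.edgeSet)))
  rw [Walk.length_map, Walk.length_map, hq'] at this
  rw [← dist_eq_cycleDist hG hl hcard hz, dist_comm]
  exact this

theorem cycleTreeCentrality_eq (hG : G.Connected) (hl : 3 ≤ l)
    (hcard : Fintype.card V = G.edgeFinset.card) (i : Fin l) :
    cycleTreeCentrality G v i = ∑ z with cycleRoot v hl z = i, cycleDist v z := by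
  rw [cycleTreeCentrality, centrality]
  let _ := Fintype.ofFinite (cycleTree G v i).supp
  calc _ = ∑ y : (cycleTree G v i).supp, cycleDist v (y : V) :=
        Finset.sum_congr rfl fun y _ => dist_toSimpleGraph_cycleTree hG hl hcard y.2
    _ = _ := (Finset.sum_subtype _
        (fun z => by simp [mem_supp_cycleTree_iff hG hl hcard]) _).symm

/-- The trees are the fibres of `cycleRoot`, so they partition the vertices. -/
theorem sum_cycleTreeCentrality (hG : G.Connected) (hl : 3 ≤ l)
    (hcard : Fintype.card V = G.edgeFinset.card) :
    ∑ i, cycleTreeCentrality G v i = ∑ z, cycleDist v z := by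
  simp_rw [cycleTreeCentrality_eq hG hl hcard]
  exact Finset.sum_fiberwise _ _ _

end Cycle

/-! ### Cover costs of a unicyclic graph -/

section Unicyclic

variable {V : Type*} [Fintype V] [DecidableEq V] [MeasurableSpace V] [DiscreteMeasurableSpace V]
  {G : SimpleGraph V} [DecidableRel G.Adj]

theorem coverCost_unicyclic (hG : G.Connected) (hcard : Fintype.card V = G.edgeFinset.card)
    {l : ℕ} (hl : 3 ≤ l) (v : (SimpleGraph.cycleGraph l).Copy G) (x : V) :
    (coverCost G x).toReal = 2 * kirchhoffIndex G + ∑ z, (cycleDist v z : ℝ)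
      - (Fintype.card V : ℝ) * (cycleDist v x : ℝ) := by
  have : Nonempty V := hG.nonempty
  have hn : 0 < Fintype.card V := Fintype.card_pos
  have hn' : (Fintype.card V : ℝ) ≠ 0 := by exact_mod_cast hn.ne'
  -- The Laplacians `n deg - 2n` and `n (2 - deg)` cancel, so `F` is constant and `∑ F = n F x`
  -- determines it.
  let F : V → ℝ := (fun u => (coverCost G u).toReal) +
    (Fintype.card V : ℝ) • fun u => (cycleDist v u : ℝ)
  have hF : ∀ u, F u = (coverCost G u).toReal + (Fintype.card V : ℝ) * (cycleDist v u : ℝ) :=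
    fun _ => rfl
  have hL : laplacian G F = 0 := by
    ext u
    simp only [F, map_add, map_smul, Pi.add_apply, Pi.smul_apply, Pi.zero_apply, smul_eq_mul,
      laplacian_coverCost hG, laplacian_cycleDist hG hl hcard, ← hcard]
    ring
  have hsum : ∑ u, F u = Fintype.card V * F x := by
    rw [Finset.sum_congr rfl fun u _ => eq_of_laplacian_eq_zero hG hL u x]
    simp
  simp_rw [hF] at hsum
  rw [Finset.sum_add_distrib, ← Finset.mul_sum, sum_coverCost hG (by lia), ← hcard] at hsum
  refine mul_left_cancel₀ hn' ?_
  linarith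

end Unicyclic

end UnicyclicWalk

/-- Let `G` be unicyclic with `n` vertices, with cycle `v_1 … v_l v_1`, and let `x` be a vertex of
`T_k`. Then the cover cost and the reverse cover cost of `x` are finite, and are given by the
two formulas below. -/
theorem mainTheorem3 {V : Type*} [Fintype V] [DecidableEq V]
    [MeasurableSpace V] [DiscreteMeasurableSpace V]
    (G : SimpleGraph V) [DecidableRel G.Adj]
    (hconn : G.Connected) (hcard : Fintype.card V = G.edgeFinset.card)
    (l : ℕ) (hl : 3 ≤ l) (v : (SimpleGraph.cycleGraph l).Copy G)
    (k : Fin l) (x : V) (hx : x ∈ (UnicyclicWalk.cycleTree G v k).supp) :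
    (UnicyclicWalk.coverCost G x ≠ ∞ ∧
      (UnicyclicWalk.coverCost G x).toReal =
        2 * UnicyclicWalk.kirchhoffIndex G
          + ∑ i : Fin l, (UnicyclicWalk.cycleTreeCentrality G v i : ℝ)
          - (Fintype.card V : ℝ) * (G.dist x (v k) : ℝ)) ∧
    (UnicyclicWalk.reverseCoverCost G x ≠ ∞ ∧
      (UnicyclicWalk.reverseCoverCost G x).toReal =
        2 * (Fintype.card V : ℝ) * UnicyclicWalk.resistanceCentrality G x
          - 2 * UnicyclicWalk.kirchhoffIndex G
          - ∑ i : Fin l, (UnicyclicWalk.cycleTreeCentrality G v i : ℝ)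
          + (Fintype.card V : ℝ) * (G.dist x (v k) : ℝ)) := by
  have hm : G.edgeFinset.card ≠ 0 := by
    have : Nonempty V := hconn.nonempty
    rw [← hcard]
    exact Fintype.card_ne_zero
  have hCC := UnicyclicWalk.coverCost_unicyclic hconn hcard hl v x
  have hsum : ∑ z, (UnicyclicWalk.cycleDist v z : ℝ) =
      ∑ i : Fin l, (UnicyclicWalk.cycleTreeCentrality G v i : ℝ) := by
    exact_mod_cast (UnicyclicWalk.sum_cycleTreeCentrality hconn hl hcard).symm
  have hadd := UnicyclicWalk.coverCost_add_reverseCoverCost hconn hm x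
  rw [hsum, ← UnicyclicWalk.dist_eq_cycleDist hconn hl hcard hx] at hCC
  rw [← hcard] at hadd
  refine ⟨⟨UnicyclicWalk.coverCost_ne_top hconn x, hCC⟩,
    UnicyclicWalk.reverseCoverCost_ne_top hconn x, ?_⟩
  linarith
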